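/- All monoids are associative with unit element $1$, not necessarily commutative. Let $H$ be a monoid, let $H^\times$ be its group of invertible elements, and let $\mathcal A(H)$ be its set of atoms, i.e. of the $u\in H\setminus H^\times$ such that $u=ab$ with $a,b\in H$ implies $a\in H^\times$ or $b\in H^\times$. $H$ is *reduced* if $H^\times=\{1\}$, *atomic* if every non-unit is a finite product of atoms, and *unit-cancellative* if $a=au$ or $a=ua$ with $a,u\in H$ implies $u\in H^\times$. For $a\in H\setminus H^\times$ let $\mathsf L(a)$ be the set of all $k\in\mathbb N=\{1,2,\dots\}$ such that $a$ is a product of $k$ atoms, let $\mathsf L(a)=\{0\}$ for $a\in H^\times$, and let $\mathcal L(H)=\{\mathsf L(a)\mid a\in H\}$. For $k\in\mathbb N$ put $\mathcal U_k(H)=\bigcup\{L\in\mathcal L(H)\mid k\in L\}$ and $\rho_k(H)=\sup\mathcal U_k(H)\in\mathbb N\cup\{\infty\}$. For $L\subset\mathbb N_0$ put $\rho(L)=\sup(L\cap\mathbb N)/\min(L\cap\mathbb N)$ if $L\cap\mathbb N\neq\emptyset$ and $\rho(L)=1$ otherwise, and let $\rho(H)=\sup\{\rho(L)\mid L\in\mathcal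 L(H)\}$. For $H$ reduced and atomic, let $\mathsf Z(H)$ be the free abelian monoid with basis $\mathcal A(H)$ if $H$ is commutative and the free monoid with basis $\mathcal A(H)$ otherwise, let $\pi\colon\mathsf Z(H)\to H$ be the canonical epimorphism, and let $\sim_H\,=\{(x,y)\in\mathsf Z(H)\times\mathsf Z(H)\mid\pi(x)=\pi(y)\}$ be the *monoid of relations*, a submonoid of $\mathsf Z(H)\times\mathsf Z(H)$. $H$ is *finitely presented* if $\mathcal A(H)$ is finite and some finite subset of $\sim_H$ generates $\sim_H$ as a congruence on $\mathsf Z(H)$. For $d\in\mathbb N$, $M\in\mathbb N_0$, a non-empty set $L\subset\mathbb N_0$ is an *almost arithmetical progression (AAP) with difference $d$ and bound $M$* if $L\subset\min L+d\mathbb Z$ and $L\cap[M+\min L,\,-M+\sup L]$ is a non-empty (finite or infinite) arithmetical progression with difference $d$, where the interval means $\mathbb N_{\ge M+\min L}$ if $L$ is infinite. **Theorem.** Let $H$ be a reduced atomic unit-cancellative monoid with $H\neq\{1\}$, and suppose that at least one of the following conditions holds: (a) $H$ is finitely presented and there is an $L\in\mathcal L(H)$ with $\rho(L)=\rho(H)<\infty$;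 (b) $H$ is cancellative and its monoid of relations $\sim_H$ is a finitely generated monoid; (c) $H$ is commutative and finitely generated. Then $\rho_k(H)<\infty$ for all $k\in\mathbb N$, there is a bound $M\in\mathbb N$ such that $\rho_k(H)-\rho_{k-1}(H)\le M$ for all $k\ge 2$, and $\mathcal L(H)$ satisfies the Structure Theorem for Unions: there are $d\in\mathbb N$ and $M'\in\mathbb N_0$ such that $\mathcal U_k(H)$ is an AAP with difference $d$ and bound $M'$ for all sufficiently large $k\in\mathbb N$. -/

import Mathlib

open scoped ENNReal

namespace SetsOfLengths

noncomputable section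

/-! ### Families of subsets of the non-negative integers -/

/-- The union `𝒰_k(𝓛)` of all members of the family `𝓛` that contain `k`. -/
def unions (𝓛 : Set (Set ℕ)) (k : ℕ) : Set ℕ :=
  {n | ∃ L ∈ 𝓛, k ∈ L ∧ n ∈ L}

/-- The supremum of a set of non-negative integers, in `ℕ ∪ {∞}`. -/
def supNat (S : Set ℕ) : ℕ∞ := ⨆ n ∈ S, (n : ℕ∞)

/-- `ρ_k(𝓛) = sup 𝒰_k(𝓛)`, in `ℕ ∪ {∞}`. -/
def rhoK (𝓛 : Set (Set ℕ)) (k : ℕ) : ℕ∞ := supNat (unions 𝓛 k)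

open Classical in
/-- The elasticity `ρ(L) = sup (L ∩ ℕ⁺) / min (L ∩ ℕ⁺)`, with `ρ(L) = 1` if `L ∩ ℕ⁺ = ∅`. -/
def setElasticity (L : Set ℕ) : ℝ≥0∞ :=
  if (L ∩ {n | 0 < n}).Nonempty then
    (⨆ n ∈ L ∩ {n | 0 < n}, (n : ℝ≥0∞)) / ((sInf (L ∩ {n | 0 < n}) : ℕ) : ℝ≥0∞)
  else 1

/-- The elasticity `ρ(𝓛)` of a family. -/
def elasticity (𝓛 : Set (Set ℕ)) : ℝ≥0∞ := ⨆ L ∈ 𝓛, setElasticity L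

/-- `𝓛` has accepted elasticity: `ρ(L) = ρ(𝓛) < ∞` for some `L ∈ 𝓛`. -/
def HasAcceptedElasticity (𝓛 : Set (Set ℕ)) : Prop :=
  ∃ L ∈ 𝓛, setElasticity L = elasticity 𝓛 ∧ elasticity 𝓛 < ⊤

/-- `S` is a (non-empty, finite or infinite) arithmetical progression with difference `d`:
`S = {m + d i | 0 ≤ i ≤ q}`, where `q = ∞` is allowed. -/
def IsArithProg (d : ℕ) (S : Set ℕ) : Prop :=
  ∃ (m : ℕ) (q : ℕ∞), S = {n | ∃ i : ℕ, (i : ℕ∞) ≤ q ∧ n = m + d * i}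

/-- `L` is an almost arithmetical progression with difference `d` and bound `M`:
`L ⊆ min L + dℤ`, and `L ∩ [M + min L, -M + sup L]` is an arithmetical progression with
difference `d`. The upper constraint `n ≤ -M + sup L` is written `n + M ≤ sup L`; it is void
when `L` is infinite. -/
def IsAAP (d M : ℕ) (L : Set ℕ) : Prop :=
  L.Nonempty ∧
  (∀ n ∈ L, ∃ i : ℤ, (n : ℤ) = (sInf L : ℕ) + d * i) ∧
  IsArithProg d (L ∩ {n | M + sInf L ≤ n ∧ ((n + M : ℕ) : ℕ∞) ≤ supNat L})

/-- The Structure Theorem for Unions holds for `𝓛`: there are `d ≥ 1` and `M ≥ 0` such that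
`𝒰_k(𝓛)` is an AAP with difference `d` and bound `M` for all sufficiently large `k`. -/
def SatisfiesStructureTheoremForUnions (𝓛 : Set (Set ℕ)) : Prop :=
  ∃ d M : ℕ, 0 < d ∧ ∃ K : ℕ, ∀ k ≥ K, IsAAP d M (unions 𝓛 k)

/-! ### Monoids -/

section Monoids

variable (H : Type*) [Monoid H]

/-- The only invertible element is `1`. -/
def IsReduced : Prop := ∀ u : H, IsUnit u → u = 1

/-- (Left and right) unit-cancellativity. -/
def IsUnitCancellative : Prop :=
  (∀ a u : H, a = a * u → IsUnit u) ∧ (∀ a u : H, a = u * a → IsUnit u)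

/-- Every non-unit is a finite product of atoms. -/
def IsAtomic : Prop :=
  ∀ a : H, ¬ IsUnit a → ∃ l : List H, (∀ u ∈ l, Irreducible u) ∧ l.prod = a

/-- Commutativity, as a property of a monoid. -/
def IsCommutative : Prop := ∀ a b : H, a * b = b * a

/-- The type of atoms of `H`. -/
abbrev Atoms : Type _ := {a : H // Irreducible a}

variable {H}

open Classical in
/-- The set of lengths `𝖫(a)`; it is `{0}` if `a` is a unit. -/
def lengths (a : H) : Set ℕ :=
  if IsUnit a then {0}
  else {k | 0 < k ∧ ∃ l : List H, (∀ u ∈ l, Irreducible u) ∧ l.prod = a ∧ l.length = k}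

variable (H)

/-- The system of sets of lengths `𝓛(H)`. -/
def lengthSystem : Set (Set ℕ) := Set.range (lengths : H → Set ℕ)

/-- The canonical map `π` from the free monoid on the atoms to `H`. -/
def freePi : FreeMonoid (Atoms H) →* H := FreeMonoid.lift Subtype.val

variable {H}

/-- For commutative `H`, the canonical map `π` from the free abelian monoid on the atoms
(multisets of atoms, written multiplicatively) to `H`. -/
def commPi (h : IsCommutative H) : Multiplicative (Multiset (Atoms H)) →* H :=
  letI : CommMonoid H := { ‹Monoid H› with mul_comm := fun a b => h a b }
  { toFun := fun z => (z.toAdd.map Subtype.val).prod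
    map_one' := by simp
    map_mul' := fun x y => by simp }

/-- The submonoid `{(x, y) | π x = π y}` of `Z × Z`. -/
def relations {Z : Type*} [Monoid Z] (π : Z →* H) : Submonoid (Z × Z) where
  carrier := {p | π p.1 = π p.2}
  one_mem' := by simp
  mul_mem' := by
    intro a b (ha : π a.1 = π a.2) (hb : π b.1 = π b.2)
    change π (a.1 * b.1) = π (a.2 * b.2)
    rw [map_mul, map_mul, ha, hb]

/-- The congruence `π x = π y` on `Z` is generated, as a congruence, by finitely many pairs. -/
def RelationsFGAsCongruence {Z : Type*} [Monoid Z] (π : Z →* H) : Prop :=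
  ∃ R : Set (Z × Z), R.Finite ∧ conGen (fun x y => (x, y) ∈ R) = Con.ker π

variable (H)

/-- The monoid of relations `∼_H ⊆ 𝖹(H) × 𝖹(H)` is finitely generated (as a monoid). Here the
factorization monoid `𝖹(H)` is the free abelian monoid on the atoms if `H` is commutative, and
the free monoid on the atoms otherwise. -/
def HasFGMonoidOfRelations : Prop :=
  (∀ h : IsCommutative H, (relations (commPi h)).FG) ∧
  (¬ IsCommutative H → (relations (freePi H)).FG)

/-- `H` is finitely presented: it has finitely many atoms, and `∼_H` is finitely generated as a
congruence on the factorization monoid `𝖹(H)` (free abelian on the atoms if `H` is commutative,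
free on the atoms otherwise). -/
def IsFinitelyPresentedMonoid : Prop :=
  {a : H | Irreducible a}.Finite ∧
  (∀ h : IsCommutative H, RelationsFGAsCongruence (commPi h)) ∧
  (¬ IsCommutative H → RelationsFGAsCongruence (freePi H))

end Monoids

end

end SetsOfLengths

/-! Only three properties of `lengthSystem H` matter: it is directed under sumsets, gaps inside its
members are at most some `D`, and `ρ_k` equals `(n / m) * k` up to a bounded error
(`HasLinearElasticity`). The last property alone bounds `ρ_k - ρ_{k-1}`. For the Structure Theorem,
let `d` generate the group of differences of lengths. Some member contains `a` and `a + d`, so a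
sumset `P` of its copies contains a progression with difference `d` longer than every gap. If `L`
joins `k` to `ρ_k`, then `L + P` has no holes modulo `d` between the shifted endpoints
(`mem_unions_of_progression`). This fills `𝒰_k` above `k`; below `k` the symmetry `x ∈ 𝒰_k ↔ k ∈
𝒰_x` takes over. Bounded gaps come from finitely many generating relations, each changing the length
by a bounded amount; under (c) Rédei's theorem supplies them. Linear elasticity comes from the
accepted ratio in (a), from a generator of the monoid of relations with extremal length ratio in
(b), and in (c) from the same argument for the relations holding in the Grothendieck group. -/

namespace SetsOfLengths

/-! ### Directed families of sets of non-negative integers -/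

/-- Any two members of the family have their sumset contained in a third one. -/
def IsDirectedFamily (𝓛 : Set (Set ℕ)) : Prop :=
  ∀ L₁ ∈ 𝓛, ∀ L₂ ∈ 𝓛, ∃ L ∈ 𝓛, ∀ a ∈ L₁, ∀ b ∈ L₂, a + b ∈ L

/-- Successive elements of any member of the family have distance at most `D`. -/
def HasGapsLE (𝓛 : Set (Set ℕ)) (D : ℕ) : Prop :=
  ∀ L ∈ 𝓛, ∀ k ∈ L, ∀ n ∈ L, k < n → ∃ l ∈ L, k < l ∧ l ≤ k + D

/-- The elasticity of the family is `n / m`, and, up to the additive constant `e`, it is attained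
along an arithmetical progression. -/
structure HasLinearElasticity (𝓛 : Set (Set ℕ)) (m n e : ℕ) : Prop where
  pos : 0 < m
  upper : ∀ k, ∀ l ∈ unions 𝓛 k, l * m ≤ n * k
  attained : ∀ j, j * n + e ∈ unions 𝓛 (j * m + e)

section Family

variable {𝓛 : Set (Set ℕ)}

theorem mem_unions_comm {k n : ℕ} : n ∈ unions 𝓛 k ↔ k ∈ unions 𝓛 n :=
  ⟨fun ⟨L, hL, h1, h2⟩ => ⟨L, hL, h2, h1⟩, fun ⟨L, hL, h1, h2⟩ => ⟨L, hL, h2, h1⟩⟩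

theorem IsDirectedFamily.add_mem_unions (hdir : IsDirectedFamily 𝓛) {k k' n n' : ℕ}
    (h : n ∈ unions 𝓛 k) (h' : n' ∈ unions 𝓛 k') : n + n' ∈ unions 𝓛 (k + k') := by
  obtain ⟨L, hL, hk, hn⟩ := h
  obtain ⟨L', hL', hk', hn'⟩ := h'
  obtain ⟨L'', hL'', hs⟩ := hdir L hL L' hL'
  exact ⟨L'', hL'', hs _ hk _ hk', hs _ hn _ hn'⟩

theorem IsDirectedFamily.self_mem_unions (hdir : IsDirectedFamily 𝓛) (h0 : 0 ∈ unions 𝓛 0)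
    (h1 : 1 ∈ unions 𝓛 1) (k : ℕ) : k ∈ unions 𝓛 k := by
  induction k with
  | zero => exact h0
  | succ k ih => exact hdir.add_mem_unions ih h1

/-- The differences of elements of members of a directed family form a subgroup of `ℤ`. -/
def differences (hdir : IsDirectedFamily 𝓛) (h0 : 0 ∈ unions 𝓛 0) : AddSubgroup ℤ where
  carrier := {z | ∃ L ∈ 𝓛, ∃ x ∈ L, ∃ y ∈ L, z = (x : ℤ) - y}
  zero_mem' := by
    obtain ⟨L, hL, h, -⟩ := h0
    exact ⟨L, hL, 0, h, 0, h, by simp⟩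
  add_mem' := by
    rintro _ _ ⟨L, hL, x, hx, y, hy, rfl⟩ ⟨L', hL', x', hx', y', hy', rfl⟩
    obtain ⟨L'', hL'', hs⟩ := hdir L hL L' hL'
    exact ⟨L'', hL'', _, hs _ hx _ hx', _, hs _ hy _ hy', by push_cast; ring⟩
  neg_mem' := by
    rintro _ ⟨L, hL, x, hx, y, hy, rfl⟩
    exact ⟨L, hL, y, hy, x, hx, by ring⟩

/-- The differences already form a subgroup of `ℤ`, so its generator is itself the difference of two
lengths in one member, not merely a combination of differences. -/
theorem exists_difference (hdir : IsDirectedFamily 𝓛) (h0 : 0 ∈ unions 𝓛 0)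
    (hne : ∃ k, ∃ l ∈ unions 𝓛 k, k < l) :
    ∃ d a : ℕ, 0 < d ∧ a + d ∈ unions 𝓛 a ∧
      ∀ L ∈ 𝓛, ∀ x ∈ L, ∀ y ∈ L, (d : ℤ) ∣ (x : ℤ) - y := by
  obtain ⟨g, hg⟩ := Int.subgroup_cyclic (differences hdir h0)
  have hdvd : ∀ L ∈ 𝓛, ∀ x ∈ L, ∀ y ∈ L, (g.natAbs : ℤ) ∣ (x : ℤ) - y := by
    intro L hL x hx y hy
    have : (x : ℤ) - y ∈ differences hdir h0 := ⟨L, hL, x, hx, y, hy, rfl⟩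
    rw [hg, AddSubgroup.mem_closure_singleton] at this
    obtain ⟨n, hn⟩ := this
    rw [Int.natAbs_dvd]
    exact ⟨n, by rw [← hn, smul_eq_mul, mul_comm]⟩
  have hmem : (g.natAbs : ℤ) ∈ differences hdir h0 := by
    have : g ∈ differences hdir h0 := by
      rw [hg]; exact AddSubgroup.mem_closure_singleton_self g
    rcases Int.natAbs_eq g with h | h
    · rwa [← h]
    · rw [h] at this
      simpa using this
  obtain ⟨k, l, ⟨L, hL, hk, hl⟩, hkl⟩ := hne
  have hpos : 0 < g.natAbs := by
    rcases Nat.eq_zero_or_pos g.natAbs with h | h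
    · have := hdvd L hL l hl k hk
      rw [h] at this
      simp at this
      omega
    · exact h
  obtain ⟨L', hL', x, hx, y, hy, hxy⟩ := hmem
  refine ⟨g.natAbs, y, hpos, ⟨L', hL', hy, ?_⟩, hdvd⟩
  rwa [show y + g.natAbs = x by omega]

/-- Sumsets of a member containing `a` and `a + d` contain long progressions. -/
theorem IsDirectedFamily.exists_progression (hdir : IsDirectedFamily 𝓛) (h0 : 0 ∈ unions 𝓛 0)
    {a d : ℕ} (h : a + d ∈ unions 𝓛 a) (t : ℕ) :
    ∃ L ∈ 𝓛, ∀ j ≤ t, t * a + j * d ∈ L := by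
  obtain ⟨L₁, hL₁, ha, had⟩ := h
  induction t with
  | zero =>
    obtain ⟨L, hL, hz, -⟩ := h0
    exact ⟨L, hL, fun j hj => by simpa [Nat.le_zero.mp hj] using hz⟩
  | succ t ih =>
    obtain ⟨L, hL, hp⟩ := ih
    obtain ⟨L', hL', hs⟩ := hdir L hL L₁ hL₁
    refine ⟨L', hL', fun j hj => ?_⟩
    rcases Nat.lt_or_ge t j with hlt | hle
    · obtain rfl : j = t + 1 := by omega
      have := hs _ (hp t le_rfl) _ had
      rwa [show t * a + t * d + (a + d) = (t + 1) * a + (t + 1) * d by ring] at this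
    · have := hs _ (hp j hle) _ ha
      rwa [show t * a + j * d + a = (t + 1) * a + j * d by ring] at this

/-- Adding a progression with difference `d` that is longer than all gaps fills all gaps. -/
theorem IsDirectedFamily.mem_unions_of_progression (hdir : IsDirectedFamily 𝓛) {D d b t : ℕ}
    (hgap : HasGapsLE 𝓛 D) (hd : 0 < d)
    (hdvd : ∀ L ∈ 𝓛, ∀ x ∈ L, ∀ y ∈ L, (d : ℤ) ∣ (x : ℤ) - y)
    {P : Set ℕ} (hP : P ∈ 𝓛) (hprog : ∀ j ≤ t, b + j * d ∈ P) (hD : D ≤ t * d)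
    {k n x : ℕ} (hkn : n ∈ unions 𝓛 k) (hx1 : k + b ≤ x) (hx2 : x ≤ n + b)
    (hx : (d : ℤ) ∣ (x : ℤ) - (k + b : ℕ)) : x ∈ unions 𝓛 (k + b) := by
  classical
  obtain ⟨L, hL, hk, hn⟩ := hkn
  -- Starting from the last `l ∈ L` with `l + b ≤ x`, the rest `x - (l + b)` is at most `D` and
  -- divisible by `d`, so the progression in `P` covers it.
  obtain ⟨l, hl, hlmax⟩ : ∃ l, (l ∈ L ∧ l + b ≤ x) ∧ ∀ y, y ∈ L ∧ y + b ≤ x → y ≤ l := by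
    have hfin : {y | y ∈ L ∧ y + b ≤ x}.Finite :=
      (Set.finite_le_nat x).subset fun y hy => by
        have := hy.2
        simp only [Set.mem_ofPred_eq]
        omega
    obtain ⟨l, hl, hmax⟩ := hfin.exists_maximal ⟨k, hk, hx1⟩
    exact ⟨l, hl, fun y hy => (le_total y l).elim id fun h => hmax hy h⟩
  have hxl : x ≤ l + b + D := by
    by_contra! hcon
    obtain ⟨l', hl', h1, h2⟩ := hgap L hL l hl.1 n hn (by omega)
    have := hlmax l' ⟨hl', by omega⟩
    omega
  have hdl : (d : ℤ) ∣ (x : ℤ) - (l + b : ℕ) := by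
    have := dvd_sub hx (hdvd L hL l hl.1 k hk)
    rwa [show (x : ℤ) - (k + b : ℕ) - ((l : ℤ) - k) = (x : ℤ) - (l + b : ℕ) by push_cast; ring]
      at this
  obtain ⟨j, hj⟩ : d ∣ x - (l + b) := by
    rw [← Int.natCast_dvd_natCast, Nat.cast_sub hl.2]
    exact hdl
  have hjt : j ≤ t := by
    have : d * j ≤ d * t := by rw [← hj, mul_comm d t]; omega
    exact Nat.le_of_mul_le_mul_left this hd
  obtain ⟨L', hL', hs⟩ := hdir L hL P hP
  refine ⟨L', hL', ?_, ?_⟩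
  · simpa using hs k hk _ (hprog 0 (Nat.zero_le t))
  · have := hs l hl.1 _ (hprog j hjt)
    rwa [show l + (b + j * d) = x by rw [mul_comm j d, ← hj]; omega] at this

/-- The first term is the least number `≥ A` congruent to `k`. The assumption `A ≤ k ≤ B` makes the
set nonempty, so that the subtraction defining the number of terms does not truncate. -/
theorem isArithProg_of_forall_mem_iff {d k A B : ℕ} (hd : 0 < d) (hA : A ≤ k) (hB : k ≤ B)
    {S : Set ℕ} (hS : ∀ x, x ∈ S ↔ (d : ℤ) ∣ (x : ℤ) - k ∧ A ≤ x ∧ x ≤ B) :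
    IsArithProg d S := by
  have hr := Nat.mod_lt (k - A) hd
  have hdm := Nat.div_add_mod (k - A) d
  set s := (k - A) % d
  set c := (k - A) / d
  refine ⟨A + s, ((B - (A + s)) / d : ℕ), Set.ext fun x => ?_⟩
  simp only [hS, Set.mem_ofPred_eq, Nat.cast_le]
  have hk : (k : ℤ) = A + d * c + s := by zify [hA] at hdm; linarith
  constructor
  · rintro ⟨⟨i, hi⟩, h1, h2⟩
    have hxi : (x : ℤ) = (A + s : ℕ) + d * (c + i) := by push_cast; rw [mul_add]; linarith
    have hci : 0 ≤ c + i := by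
      by_contra! hneg
      have : (d : ℤ) * (c + i) ≤ d * (-1) := by gcongr; omega
      push_cast at hxi
      omega
    obtain ⟨u, hu⟩ := Int.eq_ofNat_of_zero_le hci
    rw [hu] at hxi
    have hx' : x = A + s + d * u := by exact_mod_cast hxi
    refine ⟨u, ?_, hx'⟩
    rw [Nat.le_div_iff_mul_le hd, mul_comm]
    omega
  · rintro ⟨i, hi, rfl⟩
    rw [Nat.le_div_iff_mul_le hd, mul_comm] at hi
    have hs : A + s ≤ B := by
      have : 0 ≤ d * c := Nat.zero_le _
      omega
    refine ⟨⟨(i : ℤ) - c, ?_⟩, by omega, by omega⟩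
    push_cast
    rw [hk]
    ring

theorem supNat_eq_of_isGreatest {S : Set ℕ} {r : ℕ} (h : IsGreatest S r) : supNat S = r := by
  refine le_antisymm (iSup₂_le fun n hn => by exact_mod_cast h.2 hn) ?_
  exact le_iSup₂ (f := fun (n : ℕ) (_ : n ∈ S) => (n : ℕ∞)) r h.1

/-! ### Growth of `ρ_k` and the Structure Theorem from linear elasticity -/

namespace HasLinearElasticity

variable {m n e : ℕ}

theorem le_of_one_mem (hel : HasLinearElasticity 𝓛 m n e) (h1 : 1 ∈ unions 𝓛 1) : m ≤ n := by
  simpa using hel.upper 1 1 h1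

theorem exists_isGreatest (hel : HasLinearElasticity 𝓛 m n e) {k : ℕ} (hk : k ∈ unions 𝓛 k) :
    ∃ r, IsGreatest (unions 𝓛 k) r := by
  have hfin : (unions 𝓛 k).Finite := (Set.finite_le_nat (n * k)).subset fun l hl =>
    (Nat.le_mul_of_pos_right l hel.pos).trans (hel.upper k l hl)
  obtain ⟨r, hr, hmax⟩ := hfin.exists_maximal ⟨k, hk⟩
  exact ⟨r, hr, fun y hy => (le_total y r).elim id fun h => hmax hy h⟩

/-- Lower bound `ρ_k ≥ (n / m) * k - O(1)`: write `k = j * m + e + s` with `s < m` and pad the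
attained pair by `s ∈ 𝒰_s`. -/
theorem le_greatest (hel : HasLinearElasticity 𝓛 m n e) (hdir : IsDirectedFamily 𝓛)
    (hself : ∀ k, k ∈ unions 𝓛 k) {k r : ℕ} (hr : IsGreatest (unions 𝓛 k) r) :
    n * k ≤ m * r + n * (e + m) := by
  rcases Nat.lt_or_ge k e with hke | hke
  · nlinarith
  · have hdm := Nat.div_add_mod (k - e) m
    have hlt := Nat.mod_lt (k - e) hel.pos
    set s := (k - e) % m
    set j := (k - e) / m
    have hmem := hdir.add_mem_unions (hel.attained j) (hself s)
    have hk : j * m + e + s = k := by rw [mul_comm]; omega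
    rw [hk] at hmem
    have h1 := hr.2 hmem
    calc n * k = m * (j * n) + n * (e + s) := by rw [← hk]; ring
      _ ≤ m * r + n * (e + m) := by gcongr; omega

theorem greatest_le (hel : HasLinearElasticity 𝓛 m n e) (hdir : IsDirectedFamily 𝓛)
    (hself : ∀ k, k ∈ unions 𝓛 k) {k b r r' : ℕ} (hr : IsGreatest (unions 𝓛 (k + b)) r)
    (hr' : IsGreatest (unions 𝓛 k) r') : r ≤ r' + (n * (e + m) + n * b) := by
  have h1 := hel.upper _ _ hr.1
  have h2 := hel.le_greatest hdir hself hr'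
  have h3 : m * r ≤ m * (r' + (n * (e + m) + n * b)) := by
    have : n * (e + m) + n * b ≤ m * (n * (e + m) + n * b) := Nat.le_mul_of_pos_left _ hel.pos
    calc m * r ≤ n * k + n * b := by linarith
      _ ≤ m * r' + (n * (e + m) + n * b) := by linarith
      _ ≤ _ := by rw [mul_add m r']; gcongr
  exact Nat.le_of_mul_le_mul_left h3 hel.pos

theorem rhoK_bounds (hel : HasLinearElasticity 𝓛 m n e) (hdir : IsDirectedFamily 𝓛)
    (hself : ∀ k, k ∈ unions 𝓛 k) :
    ∃ M : ℕ, 0 < M ∧ (∀ k : ℕ, 1 ≤ k → rhoK 𝓛 k < ⊤) ∧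
      ∀ k : ℕ, 2 ≤ k → rhoK 𝓛 k ≤ rhoK 𝓛 (k - 1) + M := by
  -- This is the constant of `greatest_le` for `b = 1`; the final `1` only ensures positivity.
  refine ⟨n * (e + m) + n * 1 + 1, by omega, fun k _ => ?_, fun k hk => ?_⟩
  · obtain ⟨r, hr⟩ := hel.exists_isGreatest (hself k)
    rw [rhoK, supNat_eq_of_isGreatest hr]
    exact ENat.natCast_lt_top r
  · obtain ⟨k, rfl⟩ : ∃ j, k = j + 1 := ⟨k - 1, by omega⟩
    obtain ⟨r, hr⟩ := hel.exists_isGreatest (hself (k + 1))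
    obtain ⟨r', hr'⟩ := hel.exists_isGreatest (hself k)
    rw [Nat.add_sub_cancel, rhoK, rhoK, supNat_eq_of_isGreatest hr, supNat_eq_of_isGreatest hr']
    have := hel.greatest_le hdir hself hr hr'
    exact_mod_cast this.trans (by omega)

theorem structureTheorem (hel : HasLinearElasticity 𝓛 m n e) (hdir : IsDirectedFamily 𝓛)
    (hself : ∀ k, k ∈ unions 𝓛 k) {D : ℕ} (hgap : HasGapsLE 𝓛 D) :
    SatisfiesStructureTheoremForUnions 𝓛 := by
  have hmn := hel.le_of_one_mem (hself 1)
  have hm := hel.pos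
  rcases hmn.eq_or_lt with rfl | hlt
  · have hsing : ∀ k, unions 𝓛 k = {k} := by
      intro k
      refine Set.eq_singleton_iff_unique_mem.mpr ⟨hself k, fun l hl => ?_⟩
      have h1 := hel.upper k l hl
      have h2 := hel.upper l k (mem_unions_comm.mp hl)
      rw [mul_comm m] at h1 h2
      exact le_antisymm (Nat.le_of_mul_le_mul_right h1 hm) (Nat.le_of_mul_le_mul_right h2 hm)
    refine ⟨1, 0, one_pos, 0, fun k _ => ?_⟩
    have hsup : supNat {k} = k := supNat_eq_of_isGreatest (isGreatest_singleton (a := k))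
    rw [hsing k]
    refine ⟨Set.singleton_nonempty k, fun l hl => ⟨0, by simp_all⟩, k, 0, ?_⟩
    rw [hsup]
    ext x
    simp only [csInf_singleton, Set.mem_inter_iff, Set.mem_singleton_iff, Set.mem_ofPred_eq]
    constructor
    · rintro ⟨rfl, -⟩
      exact ⟨0, by simp⟩
    · rintro ⟨i, hi, rfl⟩
      obtain rfl : i = 0 := by simpa using hi
      simp
  · obtain ⟨d, a, hd, had, hdvd⟩ := exists_difference hdir (hself 0)
      ⟨1 * m + e, 1 * n + e, hel.attained 1, by omega⟩
    obtain ⟨P, hP, hprog⟩ := hdir.exists_progression (hself 0) had D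
    -- `b` is where the progression in `P` starts, `C` the error in `le_greatest`, and `M₀` the
    -- possible drop of the maximum from `𝒰_{k+b}` to `𝒰_k`. In `M`, the summands `C + m * M₀` force
    -- `ρ_x ≥ k + M₀` for `x ≥ M + min 𝒰_k`, and `b` ensures `b ≤ x`.
    set b := D * a
    set C := n * (e + m) with hC
    set M₀ := C + n * b with hM₀
    set M := C + m * M₀ + M₀ + b with hM
    -- the upper part of `𝒰_k`
    have hup : ∀ k x r, b ≤ k → k ≤ x → IsGreatest (unions 𝓛 k) r → x + M₀ ≤ r →
        (d : ℤ) ∣ (x : ℤ) - k → x ∈ unions 𝓛 k := by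
      intro k x r hk hx hr hxr hxd
      obtain ⟨k, rfl⟩ : ∃ j, k = j + b := ⟨k - b, by omega⟩
      obtain ⟨r', hr'⟩ := hel.exists_isGreatest (hself k)
      have := hel.greatest_le hdir hself hr hr'
      exact hdir.mem_unions_of_progression hgap hd hdvd hP hprog (Nat.le_mul_of_pos_right D hd)
        hr'.1 hx (by omega) hxd
    -- The threshold makes `k` lie in `[M + min 𝒰_k, ρ_k - M]`; this uses `m + 1 ≤ n`.
    refine ⟨d, M, hd, C + m * M + n * M + e + n, fun k hk => ?_⟩
    obtain ⟨r, hr⟩ := hel.exists_isGreatest (hself k)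
    have hne : (unions 𝓛 k).Nonempty := ⟨k, hself k⟩
    have hinf := Nat.sInf_mem hne
    set q := sInf (unions 𝓛 k) with hq
    have hdk : ∀ x ∈ unions 𝓛 k, ∀ y ∈ unions 𝓛 k, (d : ℤ) ∣ (x : ℤ) - y := by
      rintro x ⟨L, hL, hk1, hx⟩ y ⟨L', hL', hk2, hy⟩
      simpa using dvd_sub (hdvd L hL x hx k hk1) (hdvd L' hL' y hy k hk2)
    have hkr : k + M ≤ r := by
      have h1 := hel.le_greatest hdir hself hr
      have h2 : (m + 1) * k ≤ n * k := by gcongr; omega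
      have h3 : m * (k + M) ≤ m * r := by nlinarith
      exact Nat.le_of_mul_le_mul_left h3 hm
    have hqk : M + q ≤ k := by
      have hn : 0 < n := by omega
      have hdm := Nat.div_add_mod (k - e) n
      have hs := Nat.mod_lt (k - e) hn
      have hj : M ≤ (k - e) / n := by
        rw [Nat.le_div_iff_mul_le hn, mul_comm]; omega
      set s := (k - e) % n
      set j := (k - e) / n
      have hmem := hdir.add_mem_unions (mem_unions_comm.mp (hel.attained j)) (hself s)
      have hk' : j * n + e + s = k := by rw [mul_comm]; omega
      rw [hk'] at hmem
      have h1 : q ≤ _ := Nat.sInf_le hmem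
      have h2 : j * (m + 1) ≤ j * n := by gcongr; omega
      nlinarith
    refine ⟨hne, fun x hx => ?_, ?_⟩
    · obtain ⟨i, hi⟩ := hdk x hx q hinf
      exact ⟨i, by linarith⟩
    · rw [supNat_eq_of_isGreatest hr]
      refine isArithProg_of_forall_mem_iff (k := k) (A := M + q) (B := r - M) hd hqk (by omega) ?_
      intro x
      simp only [Set.mem_inter_iff, Set.mem_ofPred_eq, Nat.cast_le]
      constructor
      · rintro ⟨hx, h1, h2⟩
        exact ⟨hdk x hx k (hself k), h1, by omega⟩
      · rintro ⟨hxd, h1, h2⟩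
        refine ⟨?_, h1, by omega⟩
        rcases le_total k x with hkx | hxk
        · exact hup k x r (by omega) hkx hr (by omega) hxd
        · obtain ⟨rx, hrx⟩ := hel.exists_isGreatest (hself x)
          have h3 := hel.le_greatest hdir hself hrx
          have h4 := hel.upper q k (mem_unions_comm.mp hinf)
          have h5 : n * (M + q) ≤ n * x := Nat.mul_le_mul_left n h1
          have h6 : M ≤ n * M := Nat.le_mul_of_pos_left M (by omega)
          have h7 : m * (k + M₀) ≤ m * rx := by nlinarith
          have h8 := Nat.le_of_mul_le_mul_left h7 hm
          refine mem_unions_comm.mp (hup x k rx (by omega) hxk hrx h8 ?_)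
          rw [← neg_sub]
          exact (dvd_neg).mpr hxd

end HasLinearElasticity

end Family

end SetsOfLengths
namespace SetsOfLengths

/-! ### Lengths of factorizations -/

section Lengths

variable {H : Type*} [Monoid H]

/-- From `a * b = 1` follows `a * (b * a) = a`, so unit-cancellativity makes `b * a` a unit, hence
`1`. -/
theorem isUnit_left_of_mul (hred : IsReduced H) (huc : IsUnitCancellative H) {a b : H}
    (h : IsUnit (a * b)) : IsUnit a := by
  have hab := hred _ h
  have hba : IsUnit (b * a) := huc.1 a (b * a) (by rw [← mul_assoc, hab, one_mul])
  exact ⟨⟨a, b, hab, hred _ hba⟩, rfl⟩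

theorem eq_nil_of_isUnit_prod (hred : IsReduced H) (huc : IsUnitCancellative H) {l : List H}
    (hl : ∀ u ∈ l, Irreducible u) (h : IsUnit l.prod) : l = [] := by
  cases l with
  | nil => rfl
  | cons u l =>
    rw [List.prod_cons] at h
    exact absurd (isUnit_left_of_mul hred huc h) (hl u List.mem_cons_self).not_isUnit

/-- Since units have only the empty factorization, the convention `𝖫(a) = {0}` fits the general
description and the case distinction disappears. -/
theorem mem_lengths_iff (hred : IsReduced H) (huc : IsUnitCancellative H) {a : H} {k : ℕ} :
    k ∈ lengths a ↔ ∃ l : List H, (∀ u ∈ l, Irreducible u) ∧ l.prod = a ∧ l.length = k := by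
  unfold lengths
  split_ifs with ha
  · constructor
    · rintro rfl
      exact ⟨[], by simp, by simp [hred a ha], rfl⟩
    · rintro ⟨l, hl, rfl, rfl⟩
      simp [eq_nil_of_isUnit_prod hred huc hl ha]
  · constructor
    · rintro ⟨-, h⟩
      exact h
    · rintro ⟨l, hl, rfl, rfl⟩
      refine ⟨List.length_pos_of_ne_nil ?_, l, hl, rfl, rfl⟩
      rintro rfl
      simp at ha

theorem eq_zero_of_mem_lengthSystem {L : Set ℕ} (hL : L ∈ lengthSystem H) (h0 : 0 ∈ L) {k : ℕ}
    (hk : k ∈ L) : k = 0 := by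
  obtain ⟨a, rfl⟩ := hL
  unfold lengths at h0 hk
  split_ifs at h0 hk with ha
  · exact hk
  · exact absurd h0.1 (lt_irrefl 0)

theorem exists_irreducible [Nontrivial H] (hred : IsReduced H) (hat : IsAtomic H) :
    ∃ u : H, Irreducible u := by
  obtain ⟨a, ha⟩ := exists_ne (1 : H)
  obtain ⟨l, hl, rfl⟩ := hat a fun h => ha (hred a h)
  cases l with
  | nil => simp at ha
  | cons u l => exact ⟨u, hl u List.mem_cons_self⟩

variable {Z : Type*} [Monoid Z]

/-- The set of lengths of `a` consists of the values of `len` on the fibre of `π` over `a`. -/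
structure IsLengthFunction (π : Z →* H) (len : Z → ℕ) : Prop where
  len_one : len 1 = 0
  len_mul : ∀ x y, len (x * y) = len x + len y
  mem_iff : ∀ a k, k ∈ lengths a ↔ ∃ z, π z = a ∧ len z = k

theorem isLengthFunction_freePi (hred : IsReduced H) (huc : IsUnitCancellative H) :
    IsLengthFunction (freePi H) FreeMonoid.length where
  len_one := rfl
  len_mul := FreeMonoid.length_mul
  mem_iff a k := by
    rw [mem_lengths_iff hred huc]
    constructor
    · rintro ⟨l, hl, rfl, rfl⟩
      lift l to List (Atoms H) using hl
      exact ⟨FreeMonoid.ofList l, by simp [freePi, FreeMonoid.lift_apply],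
        by simp [FreeMonoid.length]⟩
    · rintro ⟨z, rfl, rfl⟩
      refine ⟨z.toList.map Subtype.val, ?_, by simp [freePi, FreeMonoid.lift_apply],
        by simp [FreeMonoid.length]⟩
      intro u hu
      obtain ⟨v, -, rfl⟩ := List.mem_map.mp hu
      exact v.2

theorem isLengthFunction_commPi (hred : IsReduced H) (huc : IsUnitCancellative H)
    (h : IsCommutative H) :
    IsLengthFunction (commPi h) (fun z => Multiset.card z.toAdd) where
  len_one := rfl
  len_mul x y := Multiset.card_add x.toAdd y.toAdd
  mem_iff a k := by
    rw [mem_lengths_iff hred huc]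
    have hpi : ∀ l : List (Atoms H),
        commPi h (Multiplicative.ofAdd (l : Multiset (Atoms H))) = (l.map Subtype.val).prod :=
      fun _ => rfl
    constructor
    · rintro ⟨l, hl, rfl, rfl⟩
      lift l to List (Atoms H) using hl
      exact ⟨Multiplicative.ofAdd l, hpi l, by simp⟩
    · rintro ⟨z, rfl, rfl⟩
      obtain ⟨l, hl⟩ := Quot.exists_rep z.toAdd
      obtain rfl : z = Multiplicative.ofAdd (l : Multiset (Atoms H)) := by
        rw [← ofAdd_toAdd z, ← hl]; rfl
      refine ⟨l.map Subtype.val, ?_, (hpi l).symm, by simp⟩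
      intro u hu
      obtain ⟨v, -, rfl⟩ := List.mem_map.mp hu
      exact v.2

/-- The congruence on `Z` of pairs that are connected inside a fibre of `π` by steps changing the
length by at most `D`. -/
def stepCon (π : Z →* H) (len : Z → ℕ) (hmul : ∀ x y, len (x * y) = len x + len y) (D : ℕ) :
    Con Z where
  r := Relation.ReflTransGen fun x y => π x = π y ∧ len x ≤ len y + D ∧ len y ≤ len x + D
  iseqv :=
    { refl := fun _ => .refl
      symm := fun h => by
        induction h with
        | refl => exact .refl
        | tail _ hstep ih => exact .head ⟨hstep.1.symm, hstep.2.2, hstep.2.1⟩ ih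
      trans := fun h h' => h.trans h' }
  mul' {w x y z} h h' := by
    refine Relation.ReflTransGen.trans (b := x * y) ?_ ?_
    · refine h.lift (· * y) fun a b hab => ⟨by simp [hab.1], ?_, ?_⟩ <;>
        simp only [hmul] <;> omega
    · refine h'.lift (x * ·) fun a b hab => ⟨by simp [hab.1], ?_, ?_⟩ <;>
        simp only [hmul] <;> omega

/-! ### Gaps and elasticity read off from the relations -/

namespace IsLengthFunction

variable {π : Z →* H} {len : Z → ℕ}

theorem mem_unions_iff (hlen : IsLengthFunction π len) {k n : ℕ} :
    n ∈ unions (lengthSystem H) k ↔ ∃ x y, π x = π y ∧ len x = k ∧ len y = n := by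
  constructor
  · rintro ⟨_, ⟨a, rfl⟩, hk, hn⟩
    obtain ⟨x, hx, hxk⟩ := (hlen.mem_iff _ _).mp hk
    obtain ⟨y, hy, hyn⟩ := (hlen.mem_iff _ _).mp hn
    exact ⟨x, y, hx.trans hy.symm, hxk, hyn⟩
  · rintro ⟨x, y, hxy, rfl, rfl⟩
    exact ⟨_, ⟨π x, rfl⟩, (hlen.mem_iff _ _).mpr ⟨x, rfl, rfl⟩,
      (hlen.mem_iff _ _).mpr ⟨y, hxy.symm, rfl⟩⟩

theorem isDirectedFamily (hlen : IsLengthFunction π len) : IsDirectedFamily (lengthSystem H) := by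
  rintro _ ⟨a, rfl⟩ _ ⟨b, rfl⟩
  refine ⟨_, ⟨a * b, rfl⟩, fun k hk n hn => ?_⟩
  rw [hlen.mem_iff] at *
  obtain ⟨x, rfl, rfl⟩ := hk
  obtain ⟨y, rfl, rfl⟩ := hn
  exact ⟨x * y, map_mul π x y, hlen.len_mul x y⟩

theorem len_pow (hlen : IsLengthFunction π len) (x : Z) (j : ℕ) : len (x ^ j) = j * len x := by
  induction j with
  | zero => simp [hlen.len_one]
  | succ j ih => rw [pow_succ, hlen.len_mul, ih]; ring

theorem len_eq_zero (hlen : IsLengthFunction π len) {x y : Z} (h : π x = π y) (hx : len x = 0) :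
    len y = 0 :=
  eq_zero_of_mem_lengthSystem ⟨π x, rfl⟩ ((hlen.mem_iff _ _).mpr ⟨x, rfl, hx⟩)
    ((hlen.mem_iff _ _).mpr ⟨y, h.symm, rfl⟩)

theorem hasGapsLE_of_stepCon (hlen : IsLengthFunction π len) {D : ℕ}
    (h : Con.ker π ≤ stepCon π len hlen.len_mul D) : HasGapsLE (lengthSystem H) D := by
  rintro _ ⟨a, rfl⟩ k hk n hn hkn
  obtain ⟨x, hx, rfl⟩ := (hlen.mem_iff _ _).mp hk
  obtain ⟨y, hy, rfl⟩ := (hlen.mem_iff _ _).mp hn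
  have hxy : Relation.ReflTransGen
      (fun x y => π x = π y ∧ len x ≤ len y + D ∧ len y ≤ len x + D) x y :=
    h (x := x) (y := y) (hx.trans hy.symm)
  -- Along the chain from `x` to `y`, the first term longer than `x` follows a term no longer than
  -- `x`, so it overshoots by at most `D`.
  have key : π y = a ∧ (len y ≤ len x ∨ ∃ w, π w = a ∧ len x < len w ∧ len w ≤ len x + D) := by
    clear hkn hn hy
    induction hxy with
    | refl => exact ⟨hx, Or.inl le_rfl⟩
    | tail _ hstep ih =>
      rename_i b c _
      refine ⟨hstep.1.symm.trans ih.1, ?_⟩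
      rcases ih.2 with hle | hw
      · rcases Nat.lt_or_ge (len x) (len c) with hlt | hge
        · exact Or.inr ⟨c, hstep.1.symm.trans ih.1, hlt, by omega⟩
        · exact Or.inl hge
      · exact Or.inr hw
  obtain ⟨w, hw, h1, h2⟩ := key.2.resolve_left (by omega)
  exact ⟨len w, (hlen.mem_iff _ _).mpr ⟨w, hw, rfl⟩, h1, h2⟩

theorem exists_stepCon_of_finite (hlen : IsLengthFunction π len) {R : Set (Z × Z)}
    (hR : R.Finite) (hπ : ∀ p ∈ R, π p.1 = π p.2) :
    ∃ D, ∀ p ∈ R, stepCon π len hlen.len_mul D p.1 p.2 := by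
  obtain ⟨D, hD⟩ := (hR.image fun p => len p.1 + len p.2).bddAbove
  refine ⟨D, fun p hp => Relation.ReflTransGen.single ⟨hπ p hp, ?_⟩⟩
  have := hD ⟨p, hp, rfl⟩
  dsimp only at this
  constructor <;> omega

theorem exists_hasGapsLE_of_conGen (hlen : IsLengthFunction π len)
    (h : RelationsFGAsCongruence π) : ∃ D, HasGapsLE (lengthSystem H) D := by
  obtain ⟨R, hfin, hR⟩ := h
  obtain ⟨D, hD⟩ := hlen.exists_stepCon_of_finite hfin fun p hp => by
    have : conGen (fun x y => (x, y) ∈ R) p.1 p.2 := ConGen.Rel.of _ _ hp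
    rw [hR] at this
    exact this
  refine ⟨D, hlen.hasGapsLE_of_stepCon ?_⟩
  rw [← hR, Con.conGen_le]
  exact fun x y hxy => hD (x, y) hxy

theorem exists_hasGapsLE_of_fg (hlen : IsLengthFunction π len) (h : (relations π).FG) :
    ∃ D, HasGapsLE (lengthSystem H) D := by
  obtain ⟨R, hR, hfin⟩ := (Submonoid.fg_iff _).mp h
  obtain ⟨D, hD⟩ := hlen.exists_stepCon_of_finite hfin fun p hp => by
    have : p ∈ relations π := hR ▸ Submonoid.subset_closure hp
    exact this
  refine ⟨D, hlen.hasGapsLE_of_stepCon fun {x y} hxy => ?_⟩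
  have hmem : (x, y) ∈ Submonoid.closure R := by rw [hR]; exact hxy
  have hle : Submonoid.closure R ≤ (stepCon π len hlen.len_mul D).submonoid :=
    (Submonoid.closure_le).mpr fun p hp => hD p hp
  exact hle hmem

/-- A finitely generated monoid of pairs containing all relations bounds the elasticity by the
largest ratio of lengths of its generators; if relations approximate this monoid well, the bound
is attained up to a constant. -/
theorem exists_hasLinearElasticity (hlen : IsLengthFunction π len) {S : Submonoid (Z × Z)}
    (hfg : S.FG) (hrel : relations π ≤ S)
    (happ : ∀ p ∈ S, ∃ z, ∀ j : ℕ, π (p.1 ^ j * z) = π (p.2 ^ j * z))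
    (hzero : ∀ p ∈ S, len p.2 = 0 → len p.1 = 0) (hone : ∃ z, len z = 1) :
    ∃ m n e, HasLinearElasticity (lengthSystem H) m n e := by
  obtain ⟨R, hR, hfin⟩ := (Submonoid.fg_iff _).mp hfg
  have hRS : R ⊆ S := hR ▸ Submonoid.subset_closure
  -- Otherwise every second component in `S` would have length `0`, contradicting the diagonal pair
  -- of an element of length `1`.
  have hne : (R ∩ {p | 0 < len p.2}).Nonempty := by
    by_contra hempty
    rw [Set.not_nonempty_iff_eq_empty, Set.eq_empty_iff_forall_notMem] at hempty
    have hall : ∀ p ∈ Submonoid.closure R, len p.2 = 0 := by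
      intro p hp
      induction hp using Submonoid.closure_induction with
      | mem p hp => by_contra hpos; exact hempty p ⟨hp, Nat.pos_of_ne_zero hpos⟩
      | one => exact hlen.len_one
      | mul p q _ _ hp hq => rw [Prod.snd_mul, hlen.len_mul, hp, hq]
    obtain ⟨z, hz⟩ := hone
    have : len z = 0 := hall (z, z) (by rw [hR]; exact hrel rfl)
    omega
  obtain ⟨g, ⟨hgR, hgpos⟩, hmax⟩ := Set.exists_max_image _
    (fun p : Z × Z => (len p.1 : ℚ) / len p.2) (hfin.inter_of_left _) hne
  replace hgpos : 0 < len g.2 := hgpos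
  obtain ⟨z, hz⟩ := happ g (hRS hgR)
  refine ⟨len g.2, len g.1, len z, hgpos, fun k l hl => ?_, fun j => ?_⟩
  -- Mediant inequality: a bound on the ratio of lengths is preserved by products, as lengths add up
  -- in both components.
  · have hall : ∀ p ∈ Submonoid.closure R, len p.1 * len g.2 ≤ len g.1 * len p.2 := by
      intro p hp
      induction hp using Submonoid.closure_induction with
      | mem p hp =>
        rcases Nat.eq_zero_or_pos (len p.2) with h0 | hpos
        · simp [hzero p (hRS hp) h0]
        · have := hmax p ⟨hp, hpos⟩
          rw [div_le_div_iff₀ (by exact_mod_cast hpos) (by exact_mod_cast hgpos)] at this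
          exact_mod_cast this
      | one => simp [hlen.len_one]
      | mul p q _ _ hp hq =>
        rw [Prod.snd_mul, Prod.fst_mul, hlen.len_mul, hlen.len_mul, add_mul, mul_add]
        exact add_le_add hp hq
    obtain ⟨x, y, hxy, rfl, rfl⟩ := hlen.mem_unions_iff.mp hl
    exact hall (y, x) (by rw [hR]; exact hrel hxy.symm)
  · refine hlen.mem_unions_iff.mpr ⟨_, _, (hz j).symm, ?_, ?_⟩ <;>
      rw [hlen.len_mul, hlen.len_pow]

end IsLengthFunction

end Lengths

/-! ### Accepted elasticity -/

theorem natCast_le_elasticity {𝓛 : Set (Set ℕ)} {L : Set ℕ} (hL : L ∈ 𝓛) {k l : ℕ} (hk : k ∈ L)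
    (hl : l ∈ L) (hk0 : 0 < k) (hl0 : 0 < l) : (l : ℝ≥0∞) / k ≤ elasticity 𝓛 := by
  refine le_trans ?_ (le_iSup₂ (f := fun (L : Set ℕ) (_ : L ∈ 𝓛) => setElasticity L) L hL)
  rw [setElasticity, if_pos ⟨k, hk, hk0⟩]
  refine ENNReal.div_le_div ?_ ?_
  · exact le_iSup₂ (f := fun (n : ℕ) (_ : n ∈ L ∩ {n | 0 < n}) => (n : ℝ≥0∞)) l ⟨hl, hl0⟩
  · have : sInf (L ∩ {n | 0 < n}) ≤ k := Nat.sInf_le ⟨hk, hk0⟩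
    exact_mod_cast this

/-- Finite elasticity forces the set to be bounded, so its supremum is a maximum. -/
theorem exists_setElasticity_eq_div {L : Set ℕ} (h : setElasticity L < ⊤)
    (hne : (L ∩ {n | 0 < n}).Nonempty) :
    ∃ m ∈ L, ∃ n ∈ L, 0 < m ∧ 0 < n ∧ setElasticity L = (n : ℝ≥0∞) / m := by
  rw [setElasticity, if_pos hne] at *
  have hmin := Nat.sInf_mem hne
  set m := sInf (L ∩ {n | 0 < n})
  have hsup : (⨆ n ∈ L ∩ {n | 0 < n}, (n : ℝ≥0∞)) ≠ ⊤ := by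
    intro htop
    rw [htop, ENNReal.top_div_of_ne_top (ENNReal.natCast_ne_top m)] at h
    exact lt_irrefl _ h
  obtain ⟨N, hN⟩ := ENNReal.exists_nat_gt hsup
  have hbdd : (L ∩ {n | 0 < n}).Finite := (Set.finite_le_nat N).subset fun x hx => by
    have : (x : ℝ≥0∞) ≤ N :=
      (le_iSup₂ (f := fun (n : ℕ) (_ : n ∈ L ∩ {n | 0 < n}) => (n : ℝ≥0∞)) x hx).trans hN.le
    exact_mod_cast this
  obtain ⟨n, hn, hmax⟩ := Set.exists_max_image _ id hbdd hne
  refine ⟨m, hmin.1, n, hn.1, hmin.2, hn.2, ?_⟩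
  congr 1
  refine le_antisymm (iSup₂_le fun x hx => ?_) ?_
  · exact_mod_cast hmax x hx
  · exact le_iSup₂ (f := fun (n : ℕ) (_ : n ∈ L ∩ {n | 0 < n}) => (n : ℝ≥0∞)) n hn

/-- Sumsets of the accepting set with itself attain the extremal ratio exactly, hence `e = 0`. -/
theorem HasAcceptedElasticity.exists_hasLinearElasticity {𝓛 : Set (Set ℕ)}
    (h : HasAcceptedElasticity 𝓛) (hdir : IsDirectedFamily 𝓛)
    (hself : ∀ k, k ∈ unions 𝓛 k)
    (hzero : ∀ L ∈ 𝓛, 0 ∈ L → ∀ k ∈ L, k = 0) :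
    ∃ m n e, HasLinearElasticity 𝓛 m n e := by
  obtain ⟨L, hL, heq, hlt⟩ := h
  obtain ⟨m, n, hm, hn, hmem, hmn⟩ :
      ∃ m n : ℕ, 0 < m ∧ 0 < n ∧ n ∈ unions 𝓛 m ∧ elasticity 𝓛 = (n : ℝ≥0∞) / m := by
    by_cases hne : (L ∩ {n | 0 < n}).Nonempty
    · rw [← heq] at hlt
      obtain ⟨m, hm, n, hn, hm0, hn0, hmn⟩ := exists_setElasticity_eq_div hlt hne
      exact ⟨m, n, hm0, hn0, ⟨L, hL, hm, hn⟩, heq ▸ hmn⟩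
    · refine ⟨1, 1, one_pos, one_pos, hself 1, ?_⟩
      rw [← heq, setElasticity, if_neg hne]
      simp
  refine ⟨m, n, 0, hm, ?_, fun j => ?_⟩
  · rintro k l ⟨L', hL', hk, hl⟩
    rcases Nat.eq_zero_or_pos l with rfl | hl0
    · simp
    rcases Nat.eq_zero_or_pos k with rfl | hk0
    · simp [hzero L' hL' hk l hl]
    have := natCast_le_elasticity hL' hk hl hk0 hl0
    rw [hmn, ENNReal.div_le_iff (by exact_mod_cast hk0.ne') (ENNReal.natCast_ne_top k),
      ← ENNReal.mul_div_right_comm,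
      ENNReal.le_div_iff_mul_le (Or.inl (by exact_mod_cast hm.ne'))
        (Or.inl (ENNReal.natCast_ne_top m))] at this
    exact_mod_cast this
  · induction j with
    | zero => simpa using hself 0
    | succ j ih =>
      have := hdir.add_mem_unions ih hmem
      simpa [add_mul] using this

end SetsOfLengths
namespace SetsOfLengths

/-! ### Finitely generated commutative monoids -/

instance Multiset.wellQuasiOrderedLE {α : Type*} [Finite α] : WellQuasiOrderedLE (Multiset α) := by
  classical
  exact (Finsupp.orderIsoMultiset (ι := α)).monotone
    |>.wellQuasiOrderedLE_of_wellQuasiOrderedLE_of_surjective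
      (Finsupp.orderIsoMultiset (ι := α)).surjective

instance Multiplicative.wellQuasiOrderedLE {α : Type*} [Preorder α] [WellQuasiOrderedLE α] :
    WellQuasiOrderedLE (Multiplicative α) :=
  Monotone.wellQuasiOrderedLE_of_wellQuasiOrderedLE_of_surjective
    (f := (Multiplicative.ofAdd : α → Multiplicative α)) (fun _ _ h => h)
    Multiplicative.ofAdd.surjective

open MonoidAlgebra in
/-- **Rédei's theorem**: every congruence on a finitely generated commutative monoid is finitely
generated. -/
theorem exists_finite_conGen_eq {M : Type*} [CommMonoid M] [Monoid.FG M] (c : Con M) :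
    ∃ R : Set (M × M), R.Finite ∧ conGen (fun x y => (x, y) ∈ R) = c := by
  classical
  have : IsNoetherianRing (MonoidAlgebra ℤ M) :=
    Algebra.FiniteType.isNoetherianRing ℤ (MonoidAlgebra ℤ M)
  let f : M × M → MonoidAlgebra ℤ M := fun p => single p.1 1 - single p.2 1
  obtain ⟨s, hs, hspan⟩ := (Submodule.fg_span_iff_fg_span_finset_subset
    (R := MonoidAlgebra ℤ M) (f '' {p | c p.1 p.2})).mp (IsNoetherian.noetherian _)
  obtain ⟨R, hR, rfl⟩ := Finset.subset_set_image_iff.mp hs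
  refine ⟨R, R.finite_toSet, le_antisymm (Con.conGen_le.mpr fun x y h => hR h) fun {x y} hxy => ?_⟩
  set c' := conGen fun x y => (x, y) ∈ (R : Set (M × M))
  have hmem : f (x, y) ∈ Submodule.span (MonoidAlgebra ℤ M) (R.image f : Set (MonoidAlgebra ℤ M)) :=
    hspan ▸ Submodule.subset_span ⟨(x, y), hxy, rfl⟩
  -- The differences `x - y` of the chosen pairs vanish in the monoid algebra of `M / c'`, hence so
  -- does the ideal they span; distinct classes remain distinct basis elements there.
  have hle : Submodule.span (MonoidAlgebra ℤ M) (R.image f : Set (MonoidAlgebra ℤ M)) ≤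
      RingHom.ker (mapDomainRingHom ℤ c'.mk') := by
    refine Submodule.span_le.mpr fun z hz => ?_
    obtain ⟨p, hp, rfl⟩ := Finset.mem_image.mp hz
    have : (c'.mk' p.1) = c'.mk' p.2 := (Con.eq c').mpr (ConGen.Rel.of _ _ hp)
    simp only [f, SetLike.mem_coe, RingHom.mem_ker, map_sub, mapDomainRingHom_apply,
      mapDomain_single, this, sub_self]
  have h0 := hle hmem
  simp only [f, RingHom.mem_ker, map_sub, mapDomainRingHom_apply, mapDomain_single, sub_eq_zero]
    at h0
  exact (Con.eq c').mp ((single_left_inj one_ne_zero).mp h0)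

section Commutative

variable {H : Type*} [Monoid H]

/-- In a reduced monoid every generating set contains all atoms. -/
theorem finite_atoms (hred : IsReduced H) (hfg : Monoid.FG H) : Finite (Atoms H) := by
  obtain ⟨s, hs, hfin⟩ := (Submonoid.fg_iff _).mp hfg.fg_top
  refine Set.Finite.to_subtype (hfin.subset fun u hu => ?_)
  obtain ⟨l, hl, hprod⟩ := Submonoid.exists_list_of_mem_closure (hs ▸ Submonoid.mem_top u)
  induction l generalizing u with
  | nil =>
    rw [List.prod_nil] at hprod
    exact absurd (hprod ▸ isUnit_one) (Irreducible.not_isUnit hu)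
  | cons a l ih =>
    rw [List.prod_cons] at hprod
    rcases Irreducible.isUnit_or_isUnit hu hprod.symm with h | h
    · rw [hred a h, one_mul] at hprod
      exact ih u hu (fun y hy => hl y (List.mem_cons_of_mem _ hy)) hprod
    · rw [hred _ h, mul_one] at hprod
      exact hprod ▸ hl a List.mem_cons_self

theorem relationsFGAsCongruence_commPi (h : IsCommutative H) [Finite (Atoms H)] :
    RelationsFGAsCongruence (commPi h) := by
  have : Monoid.FG (Multiplicative (Multiset (Atoms H))) := CommMonoid.fg_of_wellQuasiOrderedLE
  exact exists_finite_conGen_eq (Con.ker (commPi h))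

/-- Without cancellation `∼_H` need not be a finitely generated monoid (take `a + c = b + c`).
Equality in the Grothendieck group is: it is an equalizer on a free abelian monoid of finite rank.
Such an equality holds in `H` after multiplication by some `c`, and the same `c` serves all powers,
so only a bounded length `e` is lost. -/
theorem exists_hasLinearElasticity_of_isCommutative [Nontrivial H] (hred : IsReduced H)
    (huc : IsUnitCancellative H) (hat : IsAtomic H) (h : IsCommutative H) [Finite (Atoms H)] :
    ∃ m n e, HasLinearElasticity (lengthSystem H) m n e := by
  let _ : CommMonoid H := { ‹Monoid H› with mul_comm := fun a b => h a b }
  have hlen := isLengthFunction_commPi hred huc h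
  let Z := Multiplicative (Multiset (Atoms H))
  let π : Z →* H := commPi h
  let ι : H →* Algebra.GrothendieckGroup H := Algebra.GrothendieckGroup.of
  have hι : ∀ a b, ι a = ι b ↔ ∃ c, c * a = c * b := fun a b => by
    refine ((Localization.monoidOf (⊤ : Submonoid H)).eq_iff_exists).trans ?_
    simp
  have hsurj : Function.Surjective π := by
    intro a
    obtain ⟨k, hk⟩ : ∃ k, k ∈ lengths a := by
      by_cases ha : IsUnit a
      · exact ⟨0, by simp [lengths, ha]⟩
      · obtain ⟨l, hl, hla⟩ := hat a ha
        exact ⟨_, (mem_lengths_iff hred huc).mpr ⟨l, hl, hla, rfl⟩⟩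
    obtain ⟨z, hz, -⟩ := (hlen.mem_iff a k).mp hk
    exact ⟨z, hz⟩
  let f : Z × Z →* Algebra.GrothendieckGroup H := (ι.comp π).comp (MonoidHom.fst Z Z)
  let g : Z × Z →* Algebra.GrothendieckGroup H := (ι.comp π).comp (MonoidHom.snd Z Z)
  have hmem : ∀ p : Z × Z, p ∈ f.eqLocusM g ↔ ∃ c, c * π p.1 = c * π p.2 :=
    fun p => hι (π p.1) (π p.2)
  refine hlen.exists_hasLinearElasticity (Submonoid.fg_eqLocusM f g) ?_ ?_ ?_ ?_
  · intro p hp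
    exact (hmem p).mpr ⟨1, congrArg (1 * ·) hp⟩
  · intro p hp
    obtain ⟨c, hc⟩ := (hmem p).mp hp
    obtain ⟨z, rfl⟩ := hsurj c
    refine ⟨z, fun j => ?_⟩
    change π (p.1 ^ j * z) = π (p.2 ^ j * z)
    induction j with
    | zero => simp
    | succ j ih =>
      calc π (p.1 ^ (j + 1) * z) = π (p.1 ^ j) * (π z * π p.1) := by
            rw [← map_mul, ← map_mul]; congr 1; rw [pow_succ]; ac_rfl
        _ = π (p.1 ^ j * z) * π p.2 := by rw [hc, map_mul, mul_assoc]
        _ = π (p.2 ^ (j + 1) * z) := by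
            rw [ih, ← map_mul]; congr 1; rw [pow_succ]; ac_rfl
  · intro p hp h0
    obtain ⟨c, hc⟩ := (hmem p).mp hp
    -- Length `0` means `p.2 = 1`, so `c * π p.1 = c`, and unit-cancellativity gives `π p.1 = 1`.
    have h2 : p.2 = 1 := by
      rw [← ofAdd_toAdd p.2, Multiset.card_eq_zero.mp h0]; rfl
    rw [h2, map_one, mul_one] at hc
    have h1 : π p.1 = π 1 := by rw [map_one]; exact hred _ (huc.1 c _ hc.symm)
    exact hlen.len_eq_zero h1.symm hlen.len_one
  · obtain ⟨u, hu⟩ := exists_irreducible hred hat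
    exact ⟨Multiplicative.ofAdd {⟨u, hu⟩}, by simp⟩

end Commutative

/-! ### The three conditions -/

section Main

variable {H : Type*} [Monoid H]

theorem IsLengthFunction.self_mem_unions [Nontrivial H] {Z : Type*} [Monoid Z] {π : Z →* H}
    {len : Z → ℕ} (hlen : IsLengthFunction π len) (hred : IsReduced H)
    (huc : IsUnitCancellative H) (hat : IsAtomic H) (k : ℕ) :
    k ∈ unions (lengthSystem H) k := by
  refine hlen.isDirectedFamily.self_mem_unions ?_ ?_ k
  · exact hlen.mem_unions_iff.mpr ⟨1, 1, rfl, hlen.len_one, hlen.len_one⟩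
  · obtain ⟨u, hu⟩ := exists_irreducible hred hat
    have : 1 ∈ lengths u := (mem_lengths_iff hred huc).mpr ⟨[u], by simpa, by simp, rfl⟩
    exact ⟨_, ⟨u, rfl⟩, this, this⟩

theorem IsLengthFunction.exists_hasLinearElasticity_of_fg [Nontrivial H] {Z : Type*} [Monoid Z]
    {π : Z →* H} {len : Z → ℕ} (hlen : IsLengthFunction π len) (hred : IsReduced H)
    (huc : IsUnitCancellative H) (hat : IsAtomic H) (hfg : (relations π).FG) :
    ∃ m n e, HasLinearElasticity (lengthSystem H) m n e := by
  refine hlen.exists_hasLinearElasticity hfg le_rfl (fun p hp => ⟨1, fun j => ?_⟩)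
    (fun p hp h => hlen.len_eq_zero (Eq.symm hp) h) ?_
  · have : π p.1 = π p.2 := hp
    simp [this]
  · obtain ⟨z, -, -, hz, -⟩ := hlen.mem_unions_iff.mp (hlen.self_mem_unions hred huc hat 1)
    exact ⟨z, hz⟩

theorem exists_gaps_and_elasticity [Nontrivial H] (hred : IsReduced H)
    (huc : IsUnitCancellative H) (hat : IsAtomic H)
    (hcond : (IsFinitelyPresentedMonoid H ∧ HasAcceptedElasticity (lengthSystem H)) ∨
      (IsCancelMul H ∧ HasFGMonoidOfRelations H) ∨ (IsCommutative H ∧ Monoid.FG H)) :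
    (∃ D, HasGapsLE (lengthSystem H) D) ∧
      ∃ m n e, HasLinearElasticity (lengthSystem H) m n e := by
  -- Sets of lengths do not depend on the order of factors, so `freePi` computes them for
  -- commutative `H` too; the choice of `𝖹(H)` matters only for the finiteness conditions.
  have hfree := isLengthFunction_freePi hred huc
  rcases hcond with ⟨⟨-, hc, hnc⟩, hacc⟩ | ⟨-, hc, hnc⟩ | ⟨hcomm, hfg⟩
  · refine ⟨?_, hacc.exists_hasLinearElasticity hfree.isDirectedFamily
      (hfree.self_mem_unions hred huc hat)
      fun L hL h0 k hk => eq_zero_of_mem_lengthSystem hL h0 hk⟩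
    by_cases hcomm : IsCommutative H
    · exact (isLengthFunction_commPi hred huc hcomm).exists_hasGapsLE_of_conGen (hc hcomm)
    · exact hfree.exists_hasGapsLE_of_conGen (hnc hcomm)
  · by_cases hcomm : IsCommutative H
    · have hlen := isLengthFunction_commPi hred huc hcomm
      exact ⟨hlen.exists_hasGapsLE_of_fg (hc hcomm),
        hlen.exists_hasLinearElasticity_of_fg hred huc hat (hc hcomm)⟩
    · exact ⟨hfree.exists_hasGapsLE_of_fg (hnc hcomm),
        hfree.exists_hasLinearElasticity_of_fg hred huc hat (hnc hcomm)⟩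
  · have := finite_atoms hred hfg
    exact ⟨(isLengthFunction_commPi hred huc hcomm).exists_hasGapsLE_of_conGen
      (relationsFGAsCongruence_commPi hcomm),
      exists_hasLinearElasticity_of_isCommutative hred huc hat hcomm⟩

end Main

end SetsOfLengths

theorem theorem3p6 {H : Type*} [Monoid H] [Nontrivial H]
    (hred : SetsOfLengths.IsReduced H)
    (huc : SetsOfLengths.IsUnitCancellative H)
    (hat : SetsOfLengths.IsAtomic H)
    (hcond :
      (SetsOfLengths.IsFinitelyPresentedMonoid H ∧
        SetsOfLengths.HasAcceptedElasticity (SetsOfLengths.lengthSystem H)) ∨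
      (IsCancelMul H ∧ SetsOfLengths.HasFGMonoidOfRelations H) ∨
      (SetsOfLengths.IsCommutative H ∧ Monoid.FG H)) :
    (∃ M : ℕ, 0 < M ∧
      (∀ k : ℕ, 1 ≤ k → SetsOfLengths.rhoK (SetsOfLengths.lengthSystem H) k < ⊤) ∧
      ∀ k : ℕ, 2 ≤ k →
        SetsOfLengths.rhoK (SetsOfLengths.lengthSystem H) k ≤
          SetsOfLengths.rhoK (SetsOfLengths.lengthSystem H) (k - 1) + M) ∧
    SetsOfLengths.SatisfiesStructureTheoremForUnions (SetsOfLengths.lengthSystem H) := by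
  obtain ⟨⟨D, hgap⟩, m, n, e, hel⟩ := SetsOfLengths.exists_gaps_and_elasticity hred huc hat hcond
  have hlen := SetsOfLengths.isLengthFunction_freePi hred huc
  have hself := hlen.self_mem_unions hred huc hat
  exact ⟨hel.rhoK_bounds hlen.isDirectedFamily hself,
    hel.structureTheorem hlen.isDirectedFamily hself hgap⟩
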